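/- Let $f\colon\mathbb R^n\to\mathbb R^p$, $n\ge p\ge 1$, be a polynomial map. A point $t_0\in\mathbb R^p$ is a bifurcation value at infinity of $f$ if there are no compact set $K\subset\mathbb R^n$ and open disk $D\subset\mathbb R^p$ centred at $t_0$ such that $f|\colon f^{-1}(D)\setminus K\to D$ is a locally trivial $C^\infty$-fibration (fibres may be empty); $B_\infty(f)\subset\mathbb R^p$ denotes the set of these values. For $a\in\mathbb R^n$ let $\rho_a(x)=\|x-a\|^2$, let $\mathcal M_a(f)$ be the set of points $x\in\mathbb R^n$ at which the derivative of $(f,\rho_a)\colon\mathbb R^n\to\mathbb R^{p+1}$ is not surjective, and let $$\mathcal S_a(f)=\{t_0\in\mathbb R^p \mid \exists\,(x_j)_{j\in\mathbb N}\subset\mathcal M_a(f),\ \lim_{j\to\infty}\|x_j\|=\infty,\ \lim_{j\to\infty}f(x_j)=t_0\},\qquad \mathcal S_\infty(f)=\bigcap_{a\in\mathbb R^n}\mathcal S_a(f).$$ For the polynomial function $f\colon\mathbb R^2\to\mathbb R$, $f(x,y)=y(2x^2y^2-9xy+12)$, one has $0\in\mathcal S_a(f)$ for every $a\in\mathbb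 R^2$, $\mathcal S_\infty(f)=\{0\}$ and $B_\infty(f)=\emptyset$. Thus $B_\infty(f)\subsetneq\mathcal S_\infty(f)$. In particular, the conjecture that $B_\infty(f)=\mathcal S_\infty(f)$ for every polynomial map $f\colon\mathbb R^n\to\mathbb R^p$, $n\ge p\ge1$, is false, and it is already false for polynomial functions $f\colon\mathbb R^n\to\mathbb R$, $n\ge1$. -/

import Mathlib

open Filter Topology TopologicalSpace
open scoped Manifold ContDiff

noncomputable section

/-- Let `X` be a set with `X ⊆ f ⁻¹' D`. The restriction `f : X → D` is a locally trivial
`C^∞` fibration: every `t ∈ D` has an open neighbourhood `U ⊆ D` for which there are a smooth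
manifold `F` without boundary (the fibre, possibly empty) and a `C^∞` diffeomorphism from the open
set `X ∩ f ⁻¹' U` onto `U × F` whose first component is `f`. -/
def IsLocallyTrivialSmoothFibration {E G : Type*}
    [NormedAddCommGroup E] [NormedSpace ℝ E] [NormedAddCommGroup G] [NormedSpace ℝ G]
    (f : E → G) (X : Set E) (D : Set G) : Prop :=
  ∀ t ∈ D, ∃ (U : Opens G) (W : Opens E),
    t ∈ U ∧ (U : Set G) ⊆ D ∧ (W : Set E) = X ∩ f ⁻¹' (U : Set G) ∧
    ∃ (m : ℕ) (F : Type) (_ : TopologicalSpace F) (_ : ChartedSpace (EuclideanSpace ℝ (Fin m)) F),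
      T2Space F ∧ SecondCountableTopology F ∧ IsManifold (𝓡 m) ∞ F ∧
      ∃ Φ : Diffeomorph 𝓘(ℝ, E) (𝓘(ℝ, G).prod (𝓡 m)) W (U × F) ∞,
        ∀ w : W, ((Φ w).1 : G) = f (w : E)

/-- `f` is topologically trivial at infinity at `t₀`: for some compact set `K` and some disk `D`
centred at `t₀`, the restriction `f : f ⁻¹' D \ K → D` is a locally trivial `C^∞` fibration. -/
def IsTrivialAtInfinity {E G : Type*}
    [NormedAddCommGroup E] [NormedSpace ℝ E] [NormedAddCommGroup G] [NormedSpace ℝ G]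
    (f : E → G) (t₀ : G) : Prop :=
  ∃ K : Set E, IsCompact K ∧ ∃ r : ℝ, 0 < r ∧
    IsLocallyTrivialSmoothFibration f (f ⁻¹' Metric.ball t₀ r \ K) (Metric.ball t₀ r)

/-- The bifurcation locus at infinity `B_∞(f)`. -/
def bifurcationLocusAtInfinity {E G : Type*}
    [NormedAddCommGroup E] [NormedSpace ℝ E] [NormedAddCommGroup G] [NormedSpace ℝ G]
    (f : E → G) : Set G :=
  {t₀ | ¬ IsTrivialAtInfinity f t₀}

/-- The squared Euclidean distance `ρ_a(x) = ‖x - a‖²` to the centre `a`. -/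
def rho {E : Type*} [NormedAddCommGroup E] (a x : E) : ℝ := ‖x - a‖ ^ 2

/-- The Milnor set `M_a(f)`: the critical set of the map `(f, ρ_a)`, that is, the set of points at
which its derivative is not surjective. -/
def milnorSet {E G : Type*}
    [NormedAddCommGroup E] [InnerProductSpace ℝ E] [NormedAddCommGroup G] [NormedSpace ℝ G]
    (f : E → G) (a : E) : Set E :=
  {x | ¬ Function.Surjective (fderiv ℝ (fun v : E => (f v, rho a v)) x)}

/-- The set `S_a(f)` of asymptotic `ρ_a`-nonregular values. -/
def asymptoticNonregularValues {E G : Type*}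
    [NormedAddCommGroup E] [InnerProductSpace ℝ E] [NormedAddCommGroup G] [NormedSpace ℝ G]
    (f : E → G) (a : E) : Set G :=
  {t₀ | ∃ x : ℕ → E, (∀ j, x j ∈ milnorSet f a) ∧
    Tendsto (fun j => ‖x j‖) atTop atTop ∧ Tendsto (fun j => f (x j)) atTop (𝓝 t₀)}

/-- The set `S_∞(f) = ⋂ a, S_a(f)`. -/
def nonregularValuesAtInfinity {E G : Type*}
    [NormedAddCommGroup E] [InnerProductSpace ℝ E] [NormedAddCommGroup G] [NormedSpace ℝ G]
    (f : E → G) : Set G :=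
  ⋂ a : E, asymptoticNonregularValues f a

/-- The polynomial function `ℝⁿ → ℝ` given by `P`. -/
def polyFun {n : ℕ} (P : MvPolynomial (Fin n) ℝ) : EuclideanSpace ℝ (Fin n) → ℝ :=
  fun v => MvPolynomial.eval (fun i => v i) P

/-- The polynomial map `ℝⁿ → ℝᵖ` with components `P₁, …, P_p`. -/
def polyMap {n p : ℕ} (P : Fin p → MvPolynomial (Fin n) ℝ) :
    EuclideanSpace ℝ (Fin n) → EuclideanSpace ℝ (Fin p) :=
  fun v => WithLp.toLp 2 fun j => polyFun (P j) v

/-- The function `f(x, y) = y (2x²y² - 9xy + 12)` on `ℝ²`. -/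
def exampleFun : EuclideanSpace ℝ (Fin 2) → ℝ :=
  fun v => v 1 * (2 * v 0 ^ 2 * v 1 ^ 2 - 9 * v 0 * v 1 + 12)

end

/-!
Write `u = xy` and `g(u) = 2u² - 9u + 12`, so that `f(x, y) = y g(xy)`, where `g > 0` everywhere.

*No bifurcation at infinity.* The map `(x, y) ↦ (y g(xy), x / g(xy))` preserves the product of the
two coordinates, hence is a diffeomorphism of the plane with inverse
`(t, s) ↦ (s g(ts), t / g(ts))`. Its first component is `f`, so `f` is a globally trivial fibration
with fibre `ℝ`, and `B_∞(f)` is empty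
(`bifurcationLocusAtInfinity_eq_empty_of_trivialization`).

*Nonregular values.* The Milnor set `M_a(f)` is the curve
`y² (4u - 9) (y - a₁) = 6 (u - 1) (u - 2) (x - a₀)` (`mem_milnorSet_exampleFun`).
The right-hand factor `(u - 1) (u - 2)` changes sign at `u = 1`, while the left-hand side stays
bounded when `x` is large and `u` bounded. The intermediate value theorem gives points of `M_a(f)`
with `x` arbitrarily large and `1/2 ≤ u ≤ 3/2`; along them `f = (u / x) g(u)` tends to `0`. Hence
`0 ∈ S_a(f)` for every `a`. Conversely, for `a = 0` the equation becomes, after multiplication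
by `y`, `y⁴ (4u - 9) = 6 u (u - 1) (u - 2)`; if `f` is bounded, so is `y = f / g(u)`, and then `u`
is bounded. If moreover `f` stays away from `0`, then so does `y`, and `x = u / y` is bounded.
Hence `S_0(f) ⊆ {0}`.

The case of maps into `ℝᵖ` is the case `p = 1`, transferred along `ℝ ≃ ℝ¹`.
-/

/-! ### Global trivializations -/

/-- If `(f, s)` is a smooth bijection of `E` onto `G × ℝᵐ` with smooth inverse `θ`, then `f` is
trivial at infinity over every value, with empty exceptional compact set. -/
theorem bifurcationLocusAtInfinity_eq_empty_of_trivialization {E G : Type*}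
    [NormedAddCommGroup E] [NormedSpace ℝ E] [NormedAddCommGroup G] [NormedSpace ℝ G] {m : ℕ}
    {f : E → G} {s : E → EuclideanSpace ℝ (Fin m)} {θ : G × EuclideanSpace ℝ (Fin m) → E}
    (hf : ContDiff ℝ ∞ f) (hs : ContDiff ℝ ∞ s) (hθ : ContDiff ℝ ∞ θ)
    (hleft : ∀ x, θ (f x, s x) = x) (hfθ : ∀ p, f (θ p) = p.1) (hsθ : ∀ p, s (θ p) = p.2) :
    bifurcationLocusAtInfinity f = ∅ := by
  refine Set.eq_empty_iff_forall_notMem.2 fun t₀ ht₀ => ht₀ ?_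
  refine ⟨∅, isCompact_empty, 1, one_pos, fun t ht => ?_⟩
  let U : Opens G := ⟨Metric.ball t₀ 1, Metric.isOpen_ball⟩
  let W : Opens E := ⟨f ⁻¹' Metric.ball t₀ 1, Metric.isOpen_ball.preimage hf.continuous⟩
  refine ⟨U, W, ht, subset_rfl, by simp [U, W], m, EuclideanSpace ℝ (Fin m), inferInstance,
    inferInstance, inferInstance, inferInstance, inferInstance, ?_⟩
  have hval : ContMDiff 𝓘(ℝ, E) 𝓘(ℝ, E) ∞ (Subtype.val : W → E) := contMDiff_subtype_val
  have hvalU : ContMDiff 𝓘(ℝ, G) 𝓘(ℝ, G) ∞ (Subtype.val : U → G) := contMDiff_subtype_val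
  refine ⟨
    { toFun := fun w => (⟨f w, w.2⟩, s w)
      invFun := fun p => ⟨θ (p.1, p.2), by
        change f (θ (p.1, p.2)) ∈ Metric.ball t₀ 1
        rw [hfθ]
        exact p.1.2⟩
      left_inv := fun w => Subtype.ext (hleft w)
      right_inv := fun p => Prod.ext (Subtype.ext (hfθ (p.1, p.2))) (hsθ (p.1, p.2))
      contMDiff_toFun := ?_
      contMDiff_invFun := ?_ }, fun w => rfl⟩
  · refine ContMDiff.prodMk ?_ (hs.contMDiff.comp hval)
    rw [← ContMDiff.subtypeVal_comp_iff]
    exact hf.contMDiff.comp hval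
  · rw [← ContMDiff.subtypeVal_comp_iff]
    exact hθ.contMDiff.comp ((hvalU.comp contMDiff_fst).prodMk_space contMDiff_snd)

/-! ### Change of the target by a linear isomorphism -/

theorem milnorSet_continuousLinearEquiv_comp {E G G' : Type*}
    [NormedAddCommGroup E] [InnerProductSpace ℝ E] [NormedAddCommGroup G] [NormedSpace ℝ G]
    [NormedAddCommGroup G'] [NormedSpace ℝ G'] (e : G ≃L[ℝ] G') (f : E → G) (a : E) :
    milnorSet (e ∘ f) a = milnorSet f a := by
  ext x
  have h : fderiv ℝ (fun v : E => ((e ∘ f) v, rho a v)) x =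
      ((e.prodCongr (ContinuousLinearEquiv.refl ℝ ℝ) : (G × ℝ) ≃L[ℝ] (G' × ℝ)) :
        (G × ℝ) →L[ℝ] (G' × ℝ)).comp (fderiv ℝ (fun v : E => (f v, rho a v)) x) :=
    (e.prodCongr (ContinuousLinearEquiv.refl ℝ ℝ)).comp_fderiv (f := fun v : E => (f v, rho a v))
  simp only [milnorSet, Set.mem_ofPred_eq, h, ContinuousLinearMap.coe_comp,
    ContinuousLinearEquiv.coe_coe]
  rw [EquivLike.comp_surjective]

theorem map_mem_asymptoticNonregularValues {E G G' : Type*}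
    [NormedAddCommGroup E] [InnerProductSpace ℝ E] [NormedAddCommGroup G] [NormedSpace ℝ G]
    [NormedAddCommGroup G'] [NormedSpace ℝ G'] (e : G ≃L[ℝ] G') {f : E → G} {a : E} {t : G}
    (ht : t ∈ asymptoticNonregularValues f a) :
    e t ∈ asymptoticNonregularValues (e ∘ f) a := by
  obtain ⟨x, hx, hnorm, hlim⟩ := ht
  refine ⟨x, fun j => ?_, hnorm, (e.continuous.tendsto t).comp hlim⟩
  rw [milnorSet_continuousLinearEquiv_comp]
  exact hx j

/-! ### The quadratic factor -/

/-- The factor `g(u) = 2u² - 9u + 12`, for which `f(x, y) = y g(xy)`. -/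
def quadFactor (u : ℝ) : ℝ := 2 * u ^ 2 - 9 * u + 12

theorem one_le_quadFactor (u : ℝ) : 1 ≤ quadFactor u := by
  unfold quadFactor
  nlinarith [sq_nonneg (4 * u - 9)]

theorem quadFactor_ne_zero (u : ℝ) : quadFactor u ≠ 0 :=
  (zero_lt_one.trans_le (one_le_quadFactor u)).ne'

theorem contDiff_quadFactor : ContDiff ℝ ∞ quadFactor := by
  unfold quadFactor
  fun_prop

theorem exampleFun_eq (v : EuclideanSpace ℝ (Fin 2)) :
    exampleFun v = v 1 * quadFactor (v 0 * v 1) := by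
  simp only [exampleFun, quadFactor]
  ring

/-! ### Triviality of the example -/

/-- The second coordinate `x / g(xy)` of the global trivialization of `f`. -/
noncomputable def fibreCoord (v : EuclideanSpace ℝ (Fin 2)) : EuclideanSpace ℝ (Fin 1) :=
  WithLp.toLp 2 fun _ => v 0 / quadFactor (v 0 * v 1)

/-- The inverse `(t, s) ↦ (s g(ts), t / g(ts))` of the global trivialization of `f`. -/
noncomputable def trivializationInv (p : ℝ × EuclideanSpace ℝ (Fin 1)) : EuclideanSpace ℝ (Fin 2) :=
  !₂[p.2 0 * quadFactor (p.1 * p.2 0), p.1 / quadFactor (p.1 * p.2 0)]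

theorem contDiff_exampleFun : ContDiff ℝ ∞ exampleFun := by
  unfold exampleFun
  fun_prop

theorem contDiff_fibreCoord : ContDiff ℝ ∞ fibreCoord := by
  rw [contDiff_euclidean]
  intro i
  have h : ContDiff ℝ ∞ fun v : EuclideanSpace ℝ (Fin 2) => quadFactor (v 0 * v 1) :=
    contDiff_quadFactor.comp (by fun_prop)
  exact ContDiff.div (by fun_prop) h fun v => quadFactor_ne_zero _

theorem contDiff_trivializationInv : ContDiff ℝ ∞ trivializationInv := by
  have h : ContDiff ℝ ∞ fun p : ℝ × EuclideanSpace ℝ (Fin 1) => quadFactor (p.1 * p.2 0) :=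
    contDiff_quadFactor.comp (by fun_prop)
  rw [contDiff_euclidean]
  intro i
  fin_cases i
  · exact ContDiff.mul (by fun_prop) h
  · exact ContDiff.div (by fun_prop) h fun v => quadFactor_ne_zero _

theorem trivializationInv_apply (v : EuclideanSpace ℝ (Fin 2)) :
    trivializationInv (exampleFun v, fibreCoord v) = v := by
  have hg := quadFactor_ne_zero (v 0 * v 1)
  have hu : v 1 * quadFactor (v 0 * v 1) * (v 0 / quadFactor (v 0 * v 1)) = v 0 * v 1 := by
    rw [mul_assoc, mul_div_cancel₀ _ hg, mul_comm]
  ext i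
  fin_cases i <;> simp [trivializationInv, fibreCoord, exampleFun_eq, hu, hg]

theorem trivializationInv_mul (p : ℝ × EuclideanSpace ℝ (Fin 1)) :
    trivializationInv p 0 * trivializationInv p 1 = p.1 * p.2 0 := by
  have hg := quadFactor_ne_zero (p.1 * p.2 0)
  simp only [trivializationInv, Matrix.cons_val_zero, Matrix.cons_val_one]
  rw [mul_assoc, mul_div_cancel₀ _ hg, mul_comm]

theorem exampleFun_trivializationInv (p : ℝ × EuclideanSpace ℝ (Fin 1)) :
    exampleFun (trivializationInv p) = p.1 := by
  have hg := quadFactor_ne_zero (p.1 * p.2 0)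
  rw [exampleFun_eq, trivializationInv_mul]
  simp [trivializationInv, hg]

theorem fibreCoord_trivializationInv (p : ℝ × EuclideanSpace ℝ (Fin 1)) :
    fibreCoord (trivializationInv p) = p.2 := by
  have hg := quadFactor_ne_zero (p.1 * p.2 0)
  ext i
  rw [Subsingleton.elim i 0]
  simp only [fibreCoord, trivializationInv_mul]
  simp [trivializationInv, hg]

theorem bifurcationLocusAtInfinity_exampleFun_comp {G : Type*} [NormedAddCommGroup G]
    [NormedSpace ℝ G] (e : ℝ ≃L[ℝ] G) :
    bifurcationLocusAtInfinity (e ∘ exampleFun) = ∅ :=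
  bifurcationLocusAtInfinity_eq_empty_of_trivialization (s := fibreCoord)
    (θ := fun p => trivializationInv (e.symm p.1, p.2))
    (e.contDiff.comp contDiff_exampleFun) contDiff_fibreCoord
    (contDiff_trivializationInv.comp
      ((e.symm.contDiff.comp contDiff_fst).prodMk contDiff_snd))
    (fun x => by simp [trivializationInv_apply])
    (fun p => by simp [exampleFun_trivializationInv])
    (fun p => fibreCoord_trivializationInv _)

/-! ### The Milnor sets of the example -/

theorem surjective_prod_linearForms_iff (α β γ δ : ℝ) :
    Function.Surjective
      ((α • EuclideanSpace.proj 0 + β • EuclideanSpace.proj 1 :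
          EuclideanSpace ℝ (Fin 2) →L[ℝ] ℝ).prod
        (γ • EuclideanSpace.proj 0 + δ • EuclideanSpace.proj 1 :
          EuclideanSpace ℝ (Fin 2) →L[ℝ] ℝ)) ↔ α * δ - β * γ ≠ 0 := by
  constructor
  · intro h hdet
    obtain ⟨v, hv⟩ := h (1, 0)
    obtain ⟨w, hw⟩ := h (0, 1)
    simp only [ContinuousLinearMap.prod_apply, add_apply, smul_apply, PiLp.proj_apply,
      smul_eq_mul, Prod.mk.injEq] at hv hw
    -- the determinant of the form matrix times that of `(v, w)` is `1`
    have : (α * δ - β * γ) * (v 0 * w 1 - v 1 * w 0) = 1 := by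
      linear_combination (γ * w 0 + δ * w 1) * hv.1 + hw.2 - (γ * v 0 + δ * v 1) * hw.1
    simp [hdet] at this
  · rintro h ⟨c, d⟩
    refine ⟨!₂[(c * δ - β * d) / (α * δ - β * γ), (α * d - c * γ) / (α * δ - β * γ)], ?_⟩
    ext
    · simp only [ContinuousLinearMap.prod_apply, add_apply, smul_apply, PiLp.proj_apply,
        smul_eq_mul, Matrix.cons_val_zero, Matrix.cons_val_one]
      rw [← mul_div_assoc, ← mul_div_assoc, ← add_div, div_eq_iff h]
      ring
    · simp only [ContinuousLinearMap.prod_apply, add_apply, smul_apply, PiLp.proj_apply,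
        smul_eq_mul, Matrix.cons_val_zero, Matrix.cons_val_one]
      rw [← mul_div_assoc, ← mul_div_assoc, ← add_div, div_eq_iff h]
      ring

theorem mem_milnorSet_exampleFun (a v : EuclideanSpace ℝ (Fin 2)) :
    v ∈ milnorSet exampleFun a ↔
      v 1 ^ 2 * (4 * (v 0 * v 1) - 9) * (v 1 - a 1) =
        6 * (v 0 * v 1 - 1) * (v 0 * v 1 - 2) * (v 0 - a 0) := by
  have h0 : HasFDerivAt (fun w : EuclideanSpace ℝ (Fin 2) => w 0)
      (EuclideanSpace.proj 0 : EuclideanSpace ℝ (Fin 2) →L[ℝ] ℝ) v :=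
    (EuclideanSpace.proj 0 : EuclideanSpace ℝ (Fin 2) →L[ℝ] ℝ).hasFDerivAt
  have h1 : HasFDerivAt (fun w : EuclideanSpace ℝ (Fin 2) => w 1)
      (EuclideanSpace.proj 1 : EuclideanSpace ℝ (Fin 2) →L[ℝ] ℝ) v :=
    (EuclideanSpace.proj 1 : EuclideanSpace ℝ (Fin 2) →L[ℝ] ℝ).hasFDerivAt
  have hf : HasFDerivAt exampleFun
      ((v 1 ^ 2 * (4 * (v 0 * v 1) - 9)) • EuclideanSpace.proj 0 +
        (6 * (v 0 * v 1 - 1) * (v 0 * v 1 - 2)) • EuclideanSpace.proj 1 :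
          EuclideanSpace ℝ (Fin 2) →L[ℝ] ℝ) v := by
    refine (h1.mul (((((h0.pow 2).const_mul 2).mul (h1.pow 2)).sub
      ((h0.const_mul 9).mul h1)).add_const 12)).congr_fderiv ?_
    ext w
    simp
    ring
  have hrho : HasFDerivAt (rho a)
      ((2 * (v 0 - a 0)) • EuclideanSpace.proj 0 + (2 * (v 1 - a 1)) • EuclideanSpace.proj 1 :
          EuclideanSpace ℝ (Fin 2) →L[ℝ] ℝ) v := by
    have heq : rho a = fun w : EuclideanSpace ℝ (Fin 2) =>
        (w 0 - a 0) ^ 2 + (w 1 - a 1) ^ 2 := by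
      ext w
      simp [rho, EuclideanSpace.norm_sq_eq, Fin.sum_univ_two]
    rw [heq]
    refine (((h0.sub_const (a 0)).pow 2).add ((h1.sub_const (a 1)).pow 2)).congr_fderiv ?_
    ext w
    simp
  rw [milnorSet, Set.mem_ofPred_eq, (hf.prodMk hrho).fderiv, surjective_prod_linearForms_iff,
    not_not]
  constructor <;> intro h <;> linarith

/-! ### Nonregular values of the example -/

/-- For `x` large the curve `M_a(f)` has a point of abscissa `x` on which `u = xy` is close to the
root `1` of `(u - 1) (u - 2)`. The bound on `x` makes the term `6 (u - 1) (u - 2) (x - a₀)`, whose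
coefficient is `9/2` at `u = 1/2` and `-3/2` at `u = 3/2`, dominate the other one, which is at most
`63/4 (2 + |a₁|)`; this needs a constant of at least `21/2`. -/
theorem exists_mem_milnorSet_exampleFun (a : EuclideanSpace ℝ (Fin 2)) {x : ℝ} (hx1 : 1 ≤ x)
    (hx : |a 0| + 11 * (2 + |a 1|) ≤ x) :
    ∃ u ∈ Set.Icc (1 / 2 : ℝ) (3 / 2), !₂[x, u / x] ∈ milnorSet exampleFun a := by
  have hx0 : x ≠ 0 := by positivity
  let F : ℝ → ℝ := fun u =>
    6 * (u - 1) * (u - 2) * (x - a 0) - (u / x) ^ 2 * (4 * u - 9) * (u / x - a 1)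
  have hF : Continuous F := by fun_prop
  -- the term subtracted in `F` is bounded on the interval, uniformly in `x ≥ 1`
  have hbound : ∀ u ∈ Set.Icc (1 / 2 : ℝ) (3 / 2),
      |(u / x) ^ 2 * (4 * u - 9) * (u / x - a 1)| ≤ 9 / 4 * 7 * (2 + |a 1|) := by
    rintro u ⟨hu1, hu2⟩
    have hy0 : 0 ≤ u / x := by positivity
    have hy1 : u / x ≤ 3 / 2 := (div_le_self (by linarith) hx1).trans hu2
    rw [abs_mul, abs_mul]
    gcongr
    · rw [abs_of_nonneg (by positivity)]
      nlinarith
    · rw [abs_le]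
      constructor <;> linarith
    · refine (abs_sub _ _).trans ?_
      rw [abs_of_nonneg hy0]
      linarith
  have hxa : 11 * (2 + |a 1|) ≤ x - a 0 := by linarith [le_abs_self (a 0)]
  have h1 := abs_le.1 (hbound (1 / 2) (by norm_num))
  have h2 := abs_le.1 (hbound (3 / 2) (by norm_num))
  have hmem : (0 : ℝ) ∈ Set.Icc (F (3 / 2)) (F (1 / 2)) := by
    constructor
    · simp only [F]
      linarith [h2.1]
    · simp only [F]
      linarith [h1.2]
  obtain ⟨u, hu, hu0⟩ := intermediate_value_Icc' (by norm_num) hF.continuousOn hmem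
  refine ⟨u, hu, (mem_milnorSet_exampleFun _ _).2 ?_⟩
  have hux : x * (u / x) = u := by field_simp
  simp only [Matrix.cons_val_zero, Matrix.cons_val_one, hux]
  simp only [F] at hu0
  linarith

theorem zero_mem_asymptoticNonregularValues_exampleFun (a : EuclideanSpace ℝ (Fin 2)) :
    (0 : ℝ) ∈ asymptoticNonregularValues exampleFun a := by
  let x : ℕ → ℝ := fun j => j + (1 + |a 0| + 11 * (2 + |a 1|))
  have hx1 (j : ℕ) : 1 ≤ x j := by
    have : (0 : ℝ) ≤ j := j.cast_nonneg
    simp only [x]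
    linarith [abs_nonneg (a 0), abs_nonneg (a 1)]
  have hx2 (j : ℕ) : |a 0| + 11 * (2 + |a 1|) ≤ x j := by
    have : (0 : ℝ) ≤ j := j.cast_nonneg
    simp only [x]
    linarith
  have hx : Tendsto x atTop atTop :=
    tendsto_atTop_add_const_right _ _ tendsto_natCast_atTop_atTop
  choose u hu hmem using fun j => exists_mem_milnorSet_exampleFun a (hx1 j) (hx2 j)
  refine ⟨fun j => !₂[x j, u j / x j], hmem, ?_, ?_⟩
  · refine tendsto_atTop_mono (fun j => ?_) hx
    have h := PiLp.norm_apply_le (!₂[x j, u j / x j] : EuclideanSpace ℝ (Fin 2)) 0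
    exact (le_abs_self _).trans h
  · have hlim : Tendsto (fun j => 36 / x j) atTop (𝓝 0) := hx.const_div_atTop 36
    refine squeeze_zero_norm (fun j => ?_) hlim
    have hx0 : 0 < x j := by linarith [hx1 j]
    have hux : x j * (u j / x j) = u j := by field_simp
    obtain ⟨hu1, hu2⟩ := hu j
    have hg := one_le_quadFactor (u j)
    have hval : exampleFun !₂[x j, u j / x j] = u j * quadFactor (u j) / x j := by
      rw [exampleFun_eq]
      simp only [Matrix.cons_val_zero, Matrix.cons_val_one, hux]
      ring
    rw [hval, Real.norm_eq_abs, abs_of_nonneg (by positivity)]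
    gcongr
    have hg' : quadFactor (u j) ≤ 24 := by
      unfold quadFactor
      nlinarith
    nlinarith

/-- On `M_0(f)` the product `u = xy` is bounded in terms of `y`. -/
theorem sq_mul_le_of_mem_milnorSet_zero {v : EuclideanSpace ℝ (Fin 2)}
    (hv : v ∈ milnorSet exampleFun 0) : (v 0 * v 1) ^ 2 ≤ 16 + 5 * v 1 ^ 4 := by
  rw [mem_milnorSet_exampleFun] at hv
  simp only [PiLp.zero_apply, sub_zero] at hv
  set u := v 0 * v 1 with hu
  have hM : 0 ≤ v 1 ^ 4 := by positivity
  have h : v 1 ^ 4 * (4 * u - 9) = 6 * (u - 1) * (u - 2) * u := by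
    rw [hu] at hv ⊢
    linear_combination v 1 * hv
  by_contra! hlt
  have hu4 : 4 ≤ |u| := by
    nlinarith [sq_abs u, abs_nonneg u]
  have hu' : 3 * |u| ≤ 3 / 4 * u ^ 2 := by
    nlinarith [sq_abs u]
  have hup := le_abs_self u
  have hun := neg_abs_le u
  have h1 : v 1 ^ 4 * (4 * u ^ 2 - 9 * u) ≤ v 1 ^ 4 * (7 * u ^ 2) := by
    gcongr
    linarith
  have h2 : u ^ 2 * (u ^ 2 / 4) ≤ u ^ 2 * (u ^ 2 - 3 * u + 2) := by
    gcongr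
    linarith
  have h3 : v 1 ^ 4 * (4 * u ^ 2 - 9 * u) = 6 * (u ^ 2 * (u ^ 2 - 3 * u + 2)) := by
    linear_combination u * h
  have hpos : 0 < u ^ 2 := by linarith
  have h4 : u ^ 2 * (3 / 2 * u ^ 2) ≤ u ^ 2 * (7 * v 1 ^ 4) := by linarith
  have h5 := le_of_mul_le_mul_left h4 hpos
  linarith

theorem asymptoticNonregularValues_exampleFun_zero_subset :
    asymptoticNonregularValues exampleFun 0 ⊆ {0} := by
  rintro t ⟨x, hmem, hnorm, hlim⟩
  rw [Set.mem_singleton_iff]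
  by_contra ht
  have ht0 : 0 < |t| := abs_pos.2 ht
  have hup : ∀ᶠ j in atTop, |exampleFun (x j)| < |t| + 1 :=
    hlim.abs.eventually_lt_const (by linarith)
  have hlow : ∀ᶠ j in atTop, |t| / 2 < |exampleFun (x j)| :=
    hlim.abs.eventually_const_lt (by linarith)
  set B : ℝ := 16 + 5 * (|t| + 1) ^ 4 with hB
  set C : ℝ := 2 * B + 9 * (B + 1) + 12 with hC
  have hBpos : 0 < B := by positivity
  obtain ⟨j, hj1, hj2, hj3⟩ := (hup.and (hlow.and
    (hnorm.eventually_gt_atTop ((B + 1) * C / (|t| / 2) + (|t| + 1))))).exists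
  have hg := one_le_quadFactor (x j 0 * x j 1)
  have hgabs : |quadFactor (x j 0 * x j 1)| = quadFactor (x j 0 * x j 1) :=
    abs_of_nonneg (by linarith)
  rw [exampleFun_eq, abs_mul, hgabs] at hj1 hj2
  have hy : |x j 1| ≤ |t| + 1 := by
    nlinarith [abs_nonneg (x j 1)]
  have hu : (x j 0 * x j 1) ^ 2 ≤ B := by
    refine (sq_mul_le_of_mem_milnorSet_zero (hmem j)).trans ?_
    have : x j 1 ^ 4 = |x j 1| ^ 4 := (Even.pow_abs (by decide) _).symm
    rw [hB, this]
    gcongr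
  have huabs : |x j 0 * x j 1| ≤ B + 1 := by
    nlinarith [sq_abs (x j 0 * x j 1), sq_nonneg (|x j 0 * x j 1| - 1),
      abs_nonneg (x j 0 * x j 1)]
  have hgC : quadFactor (x j 0 * x j 1) ≤ C := by
    unfold quadFactor
    linarith [neg_abs_le (x j 0 * x j 1)]
  -- `|x| · |t| / 2 ≤ |x| · |f| = |u| g(u)`
  have hx : |x j 0| ≤ (B + 1) * C / (|t| / 2) := by
    rw [le_div_iff₀ (by positivity)]
    calc |x j 0| * (|t| / 2)
        ≤ |x j 0| * (|x j 1| * quadFactor (x j 0 * x j 1)) := by gcongr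
      _ = |x j 0 * x j 1| * quadFactor (x j 0 * x j 1) := by rw [abs_mul]; ring
      _ ≤ (B + 1) * C := by gcongr
  have hle : ‖x j‖ ≤ |x j 0| + |x j 1| := by
    rw [EuclideanSpace.norm_eq, Fin.sum_univ_two, Real.norm_eq_abs, Real.norm_eq_abs]
    refine Real.sqrt_le_iff.2 ⟨by positivity, ?_⟩
    nlinarith [mul_nonneg (abs_nonneg (x j 0)) (abs_nonneg (x j 1))]
  linarith

theorem nonregularValuesAtInfinity_exampleFun :
    nonregularValuesAtInfinity exampleFun = {0} := by
  refine Set.Subset.antisymm ?_ ?_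
  · exact (Set.iInter_subset _ 0).trans asymptoticNonregularValues_exampleFun_zero_subset
  · rw [Set.singleton_subset_iff]
    exact Set.mem_iInter.2 zero_mem_asymptoticNonregularValues_exampleFun

theorem bifurcationLocusAtInfinity_exampleFun :
    bifurcationLocusAtInfinity exampleFun = ∅ :=
  bifurcationLocusAtInfinity_exampleFun_comp (ContinuousLinearEquiv.refl ℝ ℝ)

/-! ### The example as a polynomial map -/

/-- The polynomial `y (2x²y² - 9xy + 12)`. -/
noncomputable def examplePoly : MvPolynomial (Fin 2) ℝ :=
  .X 1 * (2 * .X 0 ^ 2 * .X 1 ^ 2 - 9 * .X 0 * .X 1 + 12)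

theorem polyFun_examplePoly : polyFun examplePoly = exampleFun := by
  ext v
  simp [polyFun, examplePoly, exampleFun]

/-- The identification of `ℝ` with the Euclidean space `ℝ¹`. -/
noncomputable def realEquivEuclidean : ℝ ≃L[ℝ] EuclideanSpace ℝ (Fin 1) :=
  (ContinuousLinearEquiv.funUnique (Fin 1) ℝ ℝ).symm.trans (EuclideanSpace.equiv (Fin 1) ℝ).symm

theorem polyMap_examplePoly :
    polyMap (fun _ : Fin 1 => examplePoly) = realEquivEuclidean ∘ exampleFun := by
  ext v i
  simp [polyMap, polyFun_examplePoly, realEquivEuclidean]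

theorem mainTheorem4 :
    (∀ a : EuclideanSpace ℝ (Fin 2), (0 : ℝ) ∈ asymptoticNonregularValues exampleFun a) ∧
    nonregularValuesAtInfinity exampleFun = {0} ∧
    bifurcationLocusAtInfinity exampleFun = ∅ ∧
    bifurcationLocusAtInfinity exampleFun ⊂ nonregularValuesAtInfinity exampleFun ∧
    (¬ ∀ n : ℕ, 1 ≤ n → ∀ P : MvPolynomial (Fin n) ℝ,
      bifurcationLocusAtInfinity (polyFun P) = nonregularValuesAtInfinity (polyFun P)) ∧
    (¬ ∀ n p : ℕ, 1 ≤ p → p ≤ n → ∀ P : Fin p → MvPolynomial (Fin n) ℝ,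
      bifurcationLocusAtInfinity (polyMap P) = nonregularValuesAtInfinity (polyMap P)) := by
  refine ⟨zero_mem_asymptoticNonregularValues_exampleFun, nonregularValuesAtInfinity_exampleFun,
    bifurcationLocusAtInfinity_exampleFun, ?_, fun h => ?_, fun h => ?_⟩
  · rw [bifurcationLocusAtInfinity_exampleFun, nonregularValuesAtInfinity_exampleFun]
    exact Set.empty_ssubset_singleton
  · have h2 := h 2 one_le_two examplePoly
    rw [polyFun_examplePoly, bifurcationLocusAtInfinity_exampleFun,
      nonregularValuesAtInfinity_exampleFun] at h2
    exact Set.singleton_ne_empty _ h2.symm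
  · have h2 := h 2 1 le_rfl one_le_two fun _ => examplePoly
    rw [polyMap_examplePoly, bifurcationLocusAtInfinity_exampleFun_comp] at h2
    have hmem : realEquivEuclidean 0 ∈
        nonregularValuesAtInfinity (realEquivEuclidean ∘ exampleFun) :=
      Set.mem_iInter.2 fun a => map_mem_asymptoticNonregularValues realEquivEuclidean
        (zero_mem_asymptoticNonregularValues_exampleFun a)
    rw [← h2] at hmem
    exact hmem
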